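/- Setting. For $r\in\mathbb R$ let $\operatorname{sign}(r)=1$ if $r\ge 0$ and $-1$ otherwise. Let $L,T\ge 1$ be integers and $\theta>0$. An $L$-layer sLIF (sign leaky integrate-and-fire) network with leak parameter $\beta=1$, threshold $\theta$, latency $T$, widths $n_0=\dots=n_{L-1}=n$, $n_L=2$, and weight matrices $W^{(l)}\in\mathbb R^{n_l\times n_{l-1}}$ ($1\le l\le L$), on a static input $x\in\{-1,1\}^n$, is the dynamical system $$u^{(l)}_0=0,\qquad u^{(l)}_t=u^{(l)}_{t-1}+W^{(l)}s^{(l-1)}_t-\tfrac{\theta}{2}\big(s^{(l)}_{t-1}+1\big),\qquad s^{(l)}_t=\operatorname{sign}\big(u^{(l)}_t-\theta\big),\qquad s^{(0)}_t=x\quad(t\in[T]),$$ where $s^{(l)}_0=\operatorname{sign}(u^{(l)}_0-\theta)=-1$ coordinatewise for $1\le l\le L$. The associated binary classifier is $f^{L,T}(x,W)=\arg\max_{i\in\{1,2\}}\sum_{t=1}^T s^{(L)}_{t,i}$, ties being broken by an arbitrary fixed deterministic rule depending only on the two spike counts. Its two labels are identified with $1$ and $-1$. The parameters $W\in\mathbb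 R^d$, $d=\sum_{l=1}^L n_l n_{l-1}$, are random with i.i.d. $\mathcal N(0,1/n)$ entries, i.e. $W\sim\mathcal N(0,I_d/n)$. For $\nu\in[0,1]$ let $$\mathbf{ENS}_\nu=\mathbb P_{W,x,\xi}\big[f^{L,T}(x,W)\ne f^{L,T}(x\odot\xi,W)\big],$$ where $W\sim \mathcal N(0,I_d/n)$, $x$ is uniform on $\{-1,1\}^n$, $\xi$ has i.i.d. entries equal to $1$ with probability $1-\nu$ and $-1$ with probability $\nu$, and $W,x,\xi$ are independent. For $g:\{-1,1\}^n\to\mathbb R$ and $S\subseteq[n]$ let $\hat g(S)=2^{-n}\sum_{x}g(x)\prod_{i\in S}x_i$. Statement. There are absolute constants $C,c>0$ such that, with $C_{T,\theta}=2T^4C(1+\theta)$, the following holds. For all $L,T\ge1$ and $\theta>0$ there is $n_0$ such that for every $n\ge n_0$ (and every tie-breaking rule) and every noise rate $\nu'\in[0,1]$ with $\nu'\le \frac1{\sqrt{n\log n}}$, $$\mathbf{ENS}_{\nu'}\le C_{T,\theta}\,{\nu'}^{\frac1{2^{2L+1}}}\log^{3/2}n+(L-1)\,e^{-c\,{\nu'}^{\frac1{2^{2L-1}}}n}+e^{-\frac14\sqrt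 n}.$$ Moreover, for every such $n$ and every such $\nu'>0$, the random classifier has, in expectation, spectrum $\epsilon$-concentrated up to degree $1/\nu'$ with $\epsilon=C_{T,\theta}\,{\nu'}^{\frac1{2^{2L+1}}}\log^{3/2}n$, that is, $$\mathbb E_{W\sim\mathcal N(0,I_d/n)}\Big[\sum_{S\subseteq[n],\ |S|>1/\nu'}\hat f_W(S)^2\Big]\le C_{T,\theta}\,{\nu'}^{\frac1{2^{2L+1}}}\log^{3/2}n,\qquad f_W=f^{L,T}(\cdot,W).$$ -/

import Mathlib

open MeasureTheory ProbabilityTheory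

noncomputable section

/-! ### The Boolean hypercube, noise, and Fourier-Walsh analysis -/

/-- The hypercube `{-1, 1} ^ n`; the entrywise product of two points is the product in
`Fin n → ℤˣ`. -/
abbrev Cube (n : ℕ) : Type := Fin n → ℤˣ

instance : MeasurableSingletonClass ℤˣ :=
  ⟨fun u => ⟨{(u : ℤ)}, measurableSet_singleton _, by ext v; simp [Units.ext_iff]⟩⟩

/-- The law of a vector with i.i.d. Rademacher coordinates with parameter `κ`: each coordinate
is `1` with probability `κ` and `-1` with probability `1 - κ`. -/
def rad (n : ℕ) (κ : unitInterval) : Measure (Cube n) :=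
  Measure.pi fun _ => bernoulliMeasure (1 : ℤˣ) (-1) κ

/-- The uniform distribution on the hypercube. -/
def unifCube (n : ℕ) : Measure (Cube n) := uniformOn Set.univ

/-- The expected noise sensitivity at rate `ν` of a parametric family `f` of functions on the
hypercube, with parameter distributed according to `μ`: the probability, over independent
`w ∼ μ`, `x ∼ Unif`, `ξ ∼ Rad(1 - ν)`, that `f w x ≠ f w (x ⊙ ξ)`. -/
def ENS {Ω α : Type*} [MeasurableSpace Ω] {n : ℕ} (ν : unitInterval) (μ : Measure Ω)
    (f : Ω → Cube n → α) : ℝ :=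
  (μ.prod ((unifCube n).prod (rad n (unitInterval.symm ν)))).real
    {p | f p.1 p.2.1 ≠ f p.1 (p.2.1 * p.2.2)}

/-- The Walsh character `χ_S`. -/
def walsh {n : ℕ} (S : Finset (Fin n)) (x : Cube n) : ℝ := ∏ i ∈ S, ((x i : ℤ) : ℝ)

/-- The Fourier-Walsh coefficient of `g` at `S`, i.e. `2⁻ⁿ ∑ₓ g(x) χ_S(x)`. -/
def walshCoeff {n : ℕ} (g : Cube n → ℝ) (S : Finset (Fin n)) : ℝ :=
  (2 ^ n : ℝ)⁻¹ * ∑ x : Cube n, g x * walsh S x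

/-- The Fourier-Walsh expansion `g = ∑_S ĝ(S) χ_S`. -/
theorem walsh_expansion {n : ℕ} (g : Cube n → ℝ) (x : Cube n) :
    g x = ∑ S : Finset (Fin n), walshCoeff g S * walsh S x := by
  have key : ∀ y : Cube n, ∑ S : Finset (Fin n), walsh S y * walsh S x
      = if y = x then (2 : ℝ) ^ n else 0 := by
    intro y
    have h := Finset.prod_one_add (f := fun i => ((y i : ℤ) : ℝ) * ((x i : ℤ) : ℝ))
      (Finset.univ : Finset (Fin n))
    simp only [walsh, ← Finset.prod_mul_distrib]
    rw [Finset.powerset_univ] at h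
    rw [← h]
    split_ifs with hxy
    · subst hxy
      have : ∀ i, (1 : ℝ) + ((y i : ℤ) : ℝ) * ((y i : ℤ) : ℝ) = 2 := by
        intro i
        rcases Int.units_eq_one_or (y i) with h | h <;> rw [h] <;> norm_num
      simp [this]
    · obtain ⟨i, hi⟩ := Function.ne_iff.mp hxy
      refine Finset.prod_eq_zero (Finset.mem_univ i) ?_
      rcases Int.units_eq_one_or (y i) with h | h <;>
        rcases Int.units_eq_one_or (x i) with h' | h' <;> first | exact absurd (h.trans h'.symm) hi | simp [h, h']
  simp only [walshCoeff, mul_assoc, Finset.sum_mul, ← Finset.mul_sum]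
  rw [Finset.sum_comm]
  simp only [← Finset.mul_sum, key]
  simp
  field_simp

/-- The family `g`, with parameter distributed according to `μ`, has in expectation spectrum
`ε`-concentrated up to degree `k`. Integrability is part of the definition, so that the
expectation is a genuine one. -/
def ExpectedSpectrumConcentrated {Ω : Type*} [MeasurableSpace Ω] {n : ℕ} (μ : Measure Ω)
    (g : Ω → Cube n → ℝ) (ε k : ℝ) : Prop :=
  Integrable (fun w => ∑ S : Finset (Fin n) with k < (S.card : ℝ), walshCoeff (g w) S ^ 2) μ ∧
    ∫ w, ∑ S : Finset (Fin n) with k < (S.card : ℝ), walshCoeff (g w) S ^ 2 ∂μ ≤ ε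

/-! ### Sign leaky integrate-and-fire networks -/

/-- The sign function, with value `1` at `0`. -/
def sgn (r : ℝ) : ℤˣ := if 0 ≤ r then 1 else -1

/-- The membrane potential `u_t` of a sLIF neuron with leak `β` and threshold `θ`, driven by the
weighted inputs `I_t = wᵀ x_t`, `t ≥ 1`:
`u_0 = 0` and `u_{t+1} = β u_t + I_{t+1} - (θ / 2) (s_t + 1)` with `s_t = sgn (u_t - θ)`. -/
def potential (β θ : ℝ) (I : ℕ → ℝ) : ℕ → ℝ
  | 0 => 0
  | t + 1 => β * potential β θ I t + I (t + 1)
      - θ / 2 * (((sgn (potential β θ I t - θ) : ℤ) : ℝ) + 1)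

/-- The spike `s_t = sgn (u_t - θ)` of a sLIF neuron. -/
def spike (β θ : ℝ) (I : ℕ → ℝ) (t : ℕ) : ℤˣ := sgn (potential β θ I t - θ)

/-- The initial state is `s_0 = -1`, so that there is no reset at the first time step. -/
theorem spike_zero {β θ : ℝ} (hθ : 0 < θ) (I : ℕ → ℝ) : spike β θ I 0 = -1 := by
  simp [spike, potential, sgn, hθ]

/-- The parameters of an `L`-layer network whose layer widths are `N 0, …, N L`: the entry
`W l i j` is the weight from neuron `j` of layer `l` to neuron `i` of layer `l + 1`. -/
abbrev Weights (N : ℕ → ℕ) (L : ℕ) : Type :=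
  (l : Fin L) → Fin (N (l + 1)) → Fin (N l) → ℝ

/-- The Gaussian initialization: all weights are i.i.d. centred Gaussians with variance `1 / n`. -/
def gaussianInit (n : ℕ) (N : ℕ → ℕ) (L : ℕ) : Measure (Weights N L) :=
  Measure.pi fun _ => Measure.pi fun _ => Measure.pi fun _ => gaussianReal 0 ((n : NNReal)⁻¹)

/-- The spikes `s_t^{(l)}` of layer `l` (with `s_t^{(0)} = x_t`) of a sLIF network with
parameters `W` on the input sequence `x_1, x_2, …`. -/
def layerSpikes (β θ : ℝ) {N : ℕ → ℕ} {L : ℕ} (W : Weights N L) (x : ℕ → Cube (N 0)) :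
    (l : ℕ) → l ≤ L → ℕ → Cube (N l)
  | 0, _ => x
  | l + 1, h => fun t i =>
      spike β θ (fun k => ∑ j, W ⟨l, h⟩ i j *
        ((layerSpikes β θ W x l (Nat.le_of_succ_le h) k j : ℤ) : ℝ)) t

/-- The spike count `∑_{t=1}^T s_{t,i}^{(L)}` of output neuron `i`. -/
def spikeCount (β θ : ℝ) (T : ℕ) {N : ℕ → ℕ} {L : ℕ} (W : Weights N L) (x : ℕ → Cube (N 0))
    (i : Fin (N L)) : ℤ :=
  ∑ t ∈ Finset.Icc 1 T, (layerSpikes β θ W x L le_rfl t i : ℤ)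

/-- `sel` selects a maximizing index of every vector, i.e. it is a version of `arg max` with
some deterministic rule for breaking ties. -/
def IsArgmaxRule {m : ℕ} (sel : (Fin m → ℤ) → Fin m) : Prop :=
  ∀ (v : Fin m → ℤ) (i : Fin m), v i ≤ v (sel v)

/-- The spike-count classifier `f^{L,T}` of a sLIF network. -/
def classifier (β θ : ℝ) (T : ℕ) {N : ℕ → ℕ} {L : ℕ} (sel : (Fin (N L) → ℤ) → Fin (N L))
    (W : Weights N L) (x : ℕ → Cube (N 0)) : Fin (N L) :=
  sel (spikeCount β θ T W x)

/-- The classifier on static inputs, i.e. with `x_t = x` for all `t`. -/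
def staticClassifier (β θ : ℝ) (T : ℕ) {N : ℕ → ℕ} {L : ℕ} (sel : (Fin (N L) → ℤ) → Fin (N L))
    (W : Weights N L) (x : Cube (N 0)) : Fin (N L) :=
  classifier β θ T sel W fun _ => x

/-- The two labels of a binary classifier, read as the signs `1` and `-1`. -/
def labelSign {m : ℕ} (i : Fin m) : ℝ := if i.val = 0 then 1 else -1

end

/-! The proof tracks the expected fraction of flipped spikes from layer to layer. Without leak, a
potential is the accumulated current minus `θ` times the number of earlier spikes. At the first time
two spike trains of a neuron differ, these numbers agree, so the two accumulated currents straddle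
some `(m + 1) * θ` (`exists_abs_sub_le_of_spike_ne`). Given the layers below, both currents are
linear forms in the same fresh Gaussian weights. Either they differ by at least `r`, which Chebyshev
controls through the number of flips below, or the first one is within `r` of a level at least `θ`.
The latter has probability at most `2 * r / θ` whatever the variance, because a centred Gaussian
density at `y > 0` never exceeds `1 / (2 * y)` (`pi_gaussianReal_abs_sub_le_abs`). If the flip
fraction below is of order `r ^ 4`, the next one is of order `r`. After `L` layers a noise rate `ν`
yields sensitivity at most a constant times `ν ^ (1 / 4 ^ L)`, the square of the target power `ν ^
(1 / 2 ^ (2 * L + 1))`. The spare factor tends to `0` along admissible rates and absorbs every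
constant once `n` is large (`four_mul_ENS_staticClassifier_le`). Spectral concentration follows
because noise of rate `ν` damps characters of degree above `1 / ν` by a constant factor
(`sum_walshCoeff_sq_le_noiseSensitivity`). -/

/-! ### Gaussian estimates -/

/-- A linear form in i.i.d. centred Gaussians is a centred Gaussian. -/
theorem map_sum_mul_pi_gaussianReal {ι : Type*} [Fintype ι] (v : NNReal) (a : ι → ℝ) :
    (Measure.pi fun _ : ι => gaussianReal 0 v).map (fun w => ∑ j, w j * a j)
      = gaussianReal 0 ((∑ j, a j ^ 2) * v).toNNReal := by
  have hmeas : ∀ j, AEMeasurable (fun y : ℝ => y * a j) (gaussianReal 0 v) := fun j =>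
    (measurable_id.mul_const _).aemeasurable
  have hind : iIndepFun (fun (j : ι) (w : ι → ℝ) => w j * a j)
      (Measure.pi fun _ : ι => gaussianReal 0 v) := iIndepFun_pi hmeas
  have hcoord : ∀ j, (Measure.pi fun _ : ι => gaussianReal 0 v).map
      (fun w : ι → ℝ => w j * a j) = (gaussianReal 0 v).map (fun y => y * a j) := by
    intro j
    conv_rhs => rw [← (measurePreserving_eval (fun _ : ι => gaussianReal 0 v) j).map_eq,
      Measure.map_map (by fun_prop) (by fun_prop)]
    rfl
  have hlaw : ∀ j, HasGaussianLaw (fun w : ι → ℝ => w j * a j)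
      (Measure.pi fun _ : ι => gaussianReal 0 v) := fun j => by
    refine ⟨?_⟩
    rw [hcoord, gaussianReal_map_mul_const]
    infer_instance
  rw [(hind.hasGaussianLaw_fun_sum hlaw).map_eq_gaussianReal]
  congr 1
  · rw [integral_finsetSum _ fun j _ => (hlaw j).integrable]
    refine Finset.sum_eq_zero fun j _ => ?_
    have h := integral_map (μ := Measure.pi fun _ : ι => gaussianReal 0 v)
      (φ := fun w : ι → ℝ => w j * a j) (f := fun y : ℝ => y)
      (Measurable.aemeasurable (by fun_prop)) (by fun_prop)
    rw [← h, hcoord, gaussianReal_map_mul_const, integral_id_gaussianReal, mul_zero]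
  · congr 1
    have h := variance_sum_pi (μ := fun _ : ι => gaussianReal 0 v)
      (X := fun j y => y * a j) (fun j => (memLp_id_gaussianReal 2).mul_const _)
    have h2 : (∑ i, fun w : ι → ℝ => w i * a i) = fun w : ι → ℝ => ∑ j, w j * a j := by
      ext w; simp
    rw [h2] at h
    rw [h, Finset.sum_mul]
    refine Finset.sum_congr rfl fun j _ => ?_
    rw [variance_mul_const, variance_fun_id_gaussianReal, mul_comm]

/-- The density of a centred Gaussian at `y > 0` is at most `1 / (2 y)`, whatever its variance. -/
theorem gaussianPDFReal_zero_le (v : NNReal) {y : ℝ} (hy : 0 < y) :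
    gaussianPDFReal 0 v y ≤ 1 / (2 * y) := by
  rcases eq_or_ne v 0 with rfl | hv
  · simp [hy.le]
  have hv' : (0 : ℝ) < v := by positivity
  rw [gaussianPDFReal, sub_zero]
  set z := y ^ 2 / (2 * v) with hz
  have hz0 : 0 < z := by positivity
  have h1 : Real.sqrt (2 * v) ≤ Real.sqrt (2 * Real.pi * v) := by
    apply Real.sqrt_le_sqrt; nlinarith [Real.pi_gt_three]
  have hs : 0 < Real.sqrt (2 * v) := by positivity
  have hzs : z = (y / Real.sqrt (2 * v)) ^ 2 := by
    rw [div_pow, Real.sq_sqrt (by positivity)]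
  set q := y / Real.sqrt (2 * v) with hq
  have hq0 : 0 < q := by positivity
  -- Since `z = q ^ 2`, `exp z ≥ 1 + q ^ 2 ≥ 2 * q`. The factor `1 / q` then cancels the standard
  -- deviation in the normalisation.
  have hexp : Real.exp (-z) ≤ 1 / (2 * q) := by
    rw [Real.exp_neg, inv_eq_one_div]
    apply one_div_le_one_div_of_le (by positivity)
    nlinarith [Real.add_one_le_exp z, sq_nonneg (q - 1)]
  rw [neg_div]
  calc (Real.sqrt (2 * Real.pi * v))⁻¹ * Real.exp (-z)
      ≤ (Real.sqrt (2 * v))⁻¹ * (1 / (2 * q)) := by gcongr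
    _ = 1 / (2 * y) := by rw [hq]; field_simp

/-- A small-ball estimate for centred Gaussians that is uniform in the variance. -/
theorem gaussianReal_abs_sub_le (v : NNReal) {a r : ℝ} (ha : 0 < a) (hr : 0 < r) :
    gaussianReal 0 v {y | |y - a| ≤ r} ≤ ENNReal.ofReal (2 * r / a) := by
  -- For `r ≥ a / 2` the claimed bound is at least `1`. Otherwise the interval lies in `y ≥ a / 2`,
  -- where the density is at most `1 / a`.
  by_cases h : a / 2 ≤ r
  · refine prob_le_one.trans ?_
    rw [ENNReal.one_le_ofReal, le_div_iff₀ ha]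
    linarith
  push Not at h
  have hball : {y : ℝ | |y - a| ≤ r} = Metric.closedBall a r := by
    ext y; simp [Real.dist_eq]
  rcases eq_or_ne v 0 with rfl | hv
  · rw [gaussianReal_zero_var, Measure.dirac_apply' _ (by rw [hball]; exact measurableSet_closedBall)]
    rw [Set.indicator_of_notMem]
    · exact zero_le
    · simp only [Set.mem_ofPred_eq, zero_sub, abs_neg, abs_of_pos ha, not_le]
      linarith
  · rw [gaussianReal_apply 0 hv]
    calc ∫⁻ y in {y | |y - a| ≤ r}, gaussianPDF 0 v y
        ≤ ∫⁻ y in {y | |y - a| ≤ r}, ENNReal.ofReal (1 / a) := by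
          refine setLIntegral_mono (by fun_prop) fun y hy => ?_
          refine ENNReal.ofReal_le_ofReal ?_
          have hy' : a / 2 ≤ y := by
            have := (abs_le.mp (show |y - a| ≤ r from hy)).1
            linarith
          refine (gaussianPDFReal_zero_le v (by linarith)).trans ?_
          apply one_div_le_one_div_of_le ha
          linarith
      _ = ENNReal.ofReal (2 * r / a) := by
          rw [setLIntegral_const, hball, Real.volume_closedBall, ← ENNReal.ofReal_mul (by positivity)]
          congr 1; ring

/-- Chebyshev's inequality. Its linearity in `v` matters: for a random variance, the averaged bound
involves only the mean. -/
theorem gaussianReal_le_abs (v : NNReal) {r : ℝ} (hr : 0 < r) :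
    gaussianReal 0 v {y | r ≤ |y|} ≤ ENNReal.ofReal (v / r ^ 2) := by
  have h := meas_ge_le_variance_div_sq (μ := gaussianReal 0 v) (memLp_id_gaussianReal 2) hr
  simpa [variance_id_gaussianReal] using h

/-- If two linear forms in i.i.d. Gaussians have close coefficients, then it is unlikely that they
are on different sides of a level `a > 0`. -/
theorem pi_gaussianReal_abs_sub_le_abs {ι : Type*} [Fintype ι] (v : NNReal) (p q : ι → ℝ)
    {a r : ℝ} (ha : 0 < a) (hr : 0 < r) :
    (Measure.pi fun _ : ι => gaussianReal 0 v)
        {w | |∑ j, w j * p j - a| ≤ |∑ j, w j * p j - ∑ j, w j * q j|}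
      ≤ ENNReal.ofReal ((∑ j, (p j - q j) ^ 2) * v / r ^ 2 + 2 * r / a) := by
  set μ := Measure.pi fun _ : ι => gaussianReal 0 v
  have hlin : ∀ b : ι → ℝ, Measurable fun w : ι → ℝ => ∑ j, w j * b j := fun b => by fun_prop
  have hsub : {w : ι → ℝ | |∑ j, w j * p j - a| ≤ |∑ j, w j * p j - ∑ j, w j * q j|}
      ⊆ (fun w : ι → ℝ => ∑ j, w j * (p j - q j)) ⁻¹' {y | r ≤ |y|}
        ∪ (fun w : ι → ℝ => ∑ j, w j * p j) ⁻¹' {y | |y - a| ≤ r} := by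
    intro w hw
    simp only [Set.mem_ofPred_eq, Set.mem_union, Set.mem_preimage, mul_sub,
      Finset.sum_sub_distrib] at hw ⊢
    rcases le_total r |∑ j, w j * p j - ∑ j, w j * q j| with h | h
    · exact Or.inl h
    · exact Or.inr (hw.trans h)
  refine (measure_mono hsub).trans ((measure_union_le _ _).trans ?_)
  rw [ENNReal.ofReal_add (by positivity) (by positivity)]
  have h1 : MeasurableSet {y : ℝ | r ≤ |y|} := measurableSet_le (by fun_prop) (by fun_prop)
  have h2 : MeasurableSet {y : ℝ | |y - a| ≤ r} := measurableSet_le (by fun_prop) (by fun_prop)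
  refine add_le_add ?_ ?_
  · rw [← Measure.map_apply (hlin _) h1, map_sum_mul_pi_gaussianReal]
    refine (gaussianReal_le_abs _ hr).trans_eq ?_
    rw [Real.coe_toNNReal _ (by positivity)]
  · rw [← Measure.map_apply (hlin _) h2, map_sum_mul_pi_gaussianReal]
    exact gaussianReal_abs_sub_le _ ha hr

/-- Resampling one coordinate preserves a product measure. -/
theorem measurePreserving_update_pi {ι : Type*} [Fintype ι] [DecidableEq ι] {X : ι → Type*}
    [∀ i, MeasurableSpace (X i)] (μ : ∀ i, Measure (X i)) [∀ i, IsProbabilityMeasure (μ i)]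
    (i : ι) :
    MeasurePreserving (fun p : (∀ j, X j) × X i => Function.update p.1 i p.2)
      ((Measure.pi μ).prod (μ i)) (Measure.pi μ) := by
  have hmeas : Measurable fun p : (∀ j, X j) × X i => Function.update p.1 i p.2 :=
    measurable_pi_iff.mpr fun j => by
      rcases eq_or_ne j i with rfl | h
      · simpa using measurable_snd
      · simp only [Function.update_of_ne h]; fun_prop
  refine ⟨hmeas, (Measure.pi_eq fun s hs => ?_).symm⟩
  have hpre : (fun p : (∀ j, X j) × X i => Function.update p.1 i p.2) ⁻¹' Set.univ.pi s
      = (Set.univ.pi (Function.update s i Set.univ)) ×ˢ s i := by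
    ext p
    simp only [Set.mem_preimage, Set.mem_pi, Set.mem_univ, true_implies, Set.mem_prod]
    constructor
    · intro h
      refine ⟨fun j => ?_, by simpa using h i⟩
      rcases eq_or_ne j i with rfl | hj
      · simp
      · simpa [hj] using h j
    · rintro ⟨h1, h2⟩ j
      rcases eq_or_ne j i with rfl | hj
      · simpa using h2
      · simpa [hj] using h1 j
  rw [Measure.map_apply hmeas (MeasurableSet.univ_pi hs), hpre, Measure.prod_prod, Measure.pi_pi,
    ← Finset.prod_erase_mul _ _ (Finset.mem_univ i), ← Finset.prod_erase_mul _ _ (Finset.mem_univ i)]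
  simp only [Function.update_self, measure_univ, mul_one]
  congr 1
  refine Finset.prod_congr rfl fun j hj => ?_
  rw [Function.update_of_ne (Finset.ne_of_mem_erase hj)]

/-! ### Single neurons -/

/-- Zero lies between `a` and `b`, so `|a - b| = |a| + |b|`. -/
theorem abs_le_abs_sub_of_sgn_ne {a b : ℝ} (h : sgn a ≠ sgn b) : |a| ≤ |a - b| := by
  unfold sgn at h
  split_ifs at h with h1 h2 h2
  · exact absurd rfl h
  · rw [abs_of_nonneg h1, abs_of_nonneg (by linarith)]; linarith
  · rw [abs_of_neg (by linarith), abs_of_neg (by linarith)]; linarith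
  · exact absurd rfl h

/-- Without leak, the potential is the accumulated input minus `θ` times the number of earlier
spikes. -/
theorem potential_one_eq (θ : ℝ) (I : ℕ → ℝ) (t : ℕ) :
    potential 1 θ I t = ∑ k ∈ Finset.Icc 1 t, I k
      - θ * (((Finset.range t).filter fun k => spike 1 θ I k = 1).card : ℝ) := by
  induction t with
  | zero => simp [potential]
  | succ t ih =>
    rw [potential, Finset.sum_Icc_succ_top (by omega), Finset.range_add_one, Finset.filter_insert]
    change _ + _ - θ / 2 * (((spike 1 θ I t : ℤ) : ℝ) + 1) = _
    rw [ih]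
    split_ifs with h
    · rw [Finset.card_insert_of_notMem (by simp), h]
      push_cast
      ring
    · rw [(Int.units_eq_one_or _).resolve_left h]
      push_cast
      ring

/-- If the spike trains of a neuron on two input currents differ, then the accumulated currents
straddle a multiple of the threshold at some time. -/
theorem exists_abs_sub_le_of_spike_ne {θ : ℝ} {I I' : ℕ → ℝ} {T t : ℕ} (ht : t ≤ T)
    (h : spike 1 θ I t ≠ spike 1 θ I' t) :
    ∃ s ∈ Finset.range (T + 1), ∃ m ∈ Finset.range (T + 1),
      |∑ k ∈ Finset.Icc 1 s, I k - (m + 1) * θ|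
        ≤ |∑ k ∈ Finset.Icc 1 s, I k - ∑ k ∈ Finset.Icc 1 s, I' k| := by
  classical
  have hex : ∃ s, spike 1 θ I s ≠ spike 1 θ I' s := ⟨t, h⟩
  -- At the first disagreement both neurons have been reset equally often, say `m` times. Adding the
  -- firing threshold itself gives the level `(m + 1) * θ`.
  set s := Nat.find hex with hs
  have hne := Nat.find_spec hex
  have hst : s ≤ t := Nat.find_min' hex h
  have heq : ∀ k < s, spike 1 θ I k = spike 1 θ I' k := fun k hk => by
    simpa using Nat.find_min hex hk
  refine ⟨s, Finset.mem_range.mpr (by omega),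
    ((Finset.range s).filter fun k => spike 1 θ I k = 1).card, ?_, ?_⟩
  · have := (Finset.range s).card_filter_le fun k => spike 1 θ I k = 1
    rw [Finset.card_range] at this
    exact Finset.mem_range.mpr (by omega)
  · have hcount : ((Finset.range s).filter fun k => spike 1 θ I' k = 1)
        = (Finset.range s).filter fun k => spike 1 θ I k = 1 :=
      Finset.filter_congr fun k hk => by rw [heq k (Finset.mem_range.mp hk)]
    have := abs_le_abs_sub_of_sgn_ne hne
    rw [← hs, potential_one_eq, potential_one_eq, hcount] at this
    convert this using 2 <;> ring

theorem measurable_sgn : Measurable sgn :=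
  Measurable.ite measurableSet_Ici measurable_const measurable_const

theorem measurable_potential {Ω : Type*} [MeasurableSpace Ω] (β θ : ℝ) {I : Ω → ℕ → ℝ}
    (hI : ∀ k, Measurable fun ω => I ω k) (t : ℕ) :
    Measurable fun ω => potential β θ (I ω) t := by
  induction t with
  | zero => exact measurable_const
  | succ t ih =>
    have h1 : Measurable fun ω => (((sgn (potential β θ (I ω) t - θ) : ℤˣ) : ℤ) : ℝ) :=
      (measurable_of_countable fun u : ℤˣ => ((u : ℤ) : ℝ)).comp
        (measurable_sgn.comp (ih.sub_const θ))
    have h2 := hI (t + 1)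
    simp only [potential]
    fun_prop

theorem measurable_spike {Ω : Type*} [MeasurableSpace Ω] (β θ : ℝ) {I : Ω → ℕ → ℝ}
    (hI : ∀ k, Measurable fun ω => I ω k) (t : ℕ) :
    Measurable fun ω => spike β θ (I ω) t :=
  measurable_sgn.comp ((measurable_potential β θ hI t).sub_const θ)

/-! ### Layers -/

theorem measurable_layerSpikes (β θ : ℝ) {N : ℕ → ℕ} {L : ℕ} (x : ℕ → Cube (N 0)) (l : ℕ)
    (h : l ≤ L) (t : ℕ) (i : Fin (N l)) :
    Measurable fun W : Weights N L => layerSpikes β θ W x l h t i := by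
  induction l generalizing t with
  | zero => exact measurable_const
  | succ l ih =>
    refine measurable_spike β θ (fun k => ?_) t
    refine Finset.measurable_sum _ fun j _ => Measurable.mul (by fun_prop) ?_
    exact (measurable_of_countable fun u : ℤˣ => ((u : ℤ) : ℝ)).comp
      (ih (Nat.le_of_succ_le h) k j)

/-- The spikes of a layer do not depend on the weights of later layers. -/
theorem layerSpikes_update (β θ : ℝ) {N : ℕ → ℕ} {L : ℕ} (W : Weights N L) (x : ℕ → Cube (N 0))
    (m : Fin L) (V : Fin (N (m + 1)) → Fin (N m) → ℝ) (l : ℕ) (h : l ≤ L) (hlm : l ≤ m) :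
    layerSpikes β θ (Function.update W m V) x l h = layerSpikes β θ W x l h := by
  induction l with
  | zero => rfl
  | succ l ih =>
    have hne : (⟨l, h⟩ : Fin L) ≠ m := fun e => by
      have := congrArg Fin.val e
      simp only at this
      omega
    ext t i
    simp only [layerSpikes, Function.update_of_ne hne, ih (Nat.le_of_succ_le h) (by omega)]

instance (n : ℕ) (N : ℕ → ℕ) (L : ℕ) : IsProbabilityMeasure (gaussianInit n N L) := by
  unfold gaussianInit; infer_instance

/-- The incoming weights of a neuron are independent of everything that happens in the layers
below it. -/
theorem gaussianInit_le_of_update {n : ℕ} {N : ℕ → ℕ} {L : ℕ} (m : Fin L) (i : Fin (N (m + 1)))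
    {E : Set (Weights N L × (Fin (N m) → ℝ))} (hE : MeasurableSet E)
    (hupd : ∀ W V w, ((Function.update W m V, w) ∈ E ↔ (W, w) ∈ E))
    {g : Weights N L → ENNReal}
    (hg : ∀ W, (Measure.pi fun _ => gaussianReal 0 ((n : NNReal)⁻¹)) {w | (W, w) ∈ E} ≤ g W) :
    gaussianInit n N L {W | (W, W m i) ∈ E} ≤ ∫⁻ W, g W ∂gaussianInit n N L := by
  set γ : Measure (Fin (N m) → ℝ) := Measure.pi fun _ => gaussianReal 0 ((n : NNReal)⁻¹)
  have hmp := measurePreserving_update_pi (ι := Fin L)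
    (fun l : Fin L => (Measure.pi fun _ => Measure.pi fun _ =>
      gaussianReal 0 ((n : NNReal)⁻¹) : Measure (Fin (N (l + 1)) → Fin (N l) → ℝ))) m
  have hA : MeasurableSet {W : Weights N L | (W, W m i) ∈ E} :=
    (measurable_id.prodMk ((measurable_pi_apply i).comp (measurable_pi_apply m))) hE
  -- Resampling layer `m` leaves the law unchanged, and by `hupd` the old `W` enters `E` as if
  -- untouched, so only the fresh row `V i` is random once `W` is fixed.
  have h := hmp.measure_preimage hA.nullMeasurableSet
  change _ = gaussianInit n N L _ at h
  rw [← h, Measure.prod_apply (hmp.measurable hA)]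
  refine lintegral_mono fun W => le_trans (le_of_eq ?_) (hg W)
  have hset : Prod.mk W ⁻¹' ((fun p : Weights N L × (Fin (N (m + 1)) → Fin (N m) → ℝ) =>
      Function.update p.1 m p.2) ⁻¹' {W : Weights N L | (W, W m i) ∈ E})
      = (fun V : Fin (N (m + 1)) → Fin (N m) → ℝ => V i) ⁻¹' {w | (W, w) ∈ E} := by
    ext V
    simp [hupd]
  have hsec : MeasurableSet {w | (W, w) ∈ E} := measurable_prodMk_left hE
  refine (congrArg _ hset).trans ?_
  exact (measurePreserving_eval (fun _ : Fin (N (m + 1)) => γ) i).measure_preimage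
    hsec.nullMeasurableSet

/-! ### Propagation of flips through one layer. -/

noncomputable section

/-- The event that two input sequences produce different spikes at a given neuron and time. -/
def flipEvent (θ : ℝ) {N : ℕ → ℕ} {L : ℕ} (x x' : ℕ → Cube (N 0)) (l : ℕ) (h : l ≤ L) (k : ℕ)
    (j : Fin (N l)) : Set (Weights N L) :=
  {W | layerSpikes 1 θ W x l h k j ≠ layerSpikes 1 θ W x' l h k j}

/-- The expected number of pairs (time, neuron of layer `l`) at which the spikes caused by two
input sequences differ. -/
def expectedFlips (n : ℕ) (θ : ℝ) (T : ℕ) {N : ℕ → ℕ} {L : ℕ} (x x' : ℕ → Cube (N 0)) (l : ℕ)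
    (h : l ≤ L) : ℝ :=
  ∑ j, ∑ k ∈ Finset.Icc 1 T, (gaussianInit n N L).real (flipEvent θ x x' l h k j)

end

theorem measurableSet_flipEvent (θ : ℝ) {N : ℕ → ℕ} {L : ℕ} (x x' : ℕ → Cube (N 0)) (l : ℕ)
    (h : l ≤ L) (k : ℕ) (j : Fin (N l)) : MeasurableSet (flipEvent θ x x' l h k j) :=
  (measurableSet_eq_fun (measurable_layerSpikes 1 θ x l h k j)
    (measurable_layerSpikes 1 θ x' l h k j)).compl

/-- A flip changes a spike by `2`, hence contributes `4` to the sum of squares; Cauchy–Schwarz over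
at most `T` times costs the factor `T`. -/
theorem sum_layerSpikes_sub_sq_le (θ : ℝ) {N : ℕ → ℕ} {L : ℕ} (W : Weights N L)
    (x x' : ℕ → Cube (N 0)) (l : ℕ) (h : l ≤ L) (j : Fin (N l)) {s T : ℕ} (hs : s ≤ T) :
    (∑ k ∈ Finset.Icc 1 s, ((layerSpikes 1 θ W x l h k j : ℤ) : ℝ)
        - ∑ k ∈ Finset.Icc 1 s, ((layerSpikes 1 θ W x' l h k j : ℤ) : ℝ)) ^ 2
      ≤ 4 * T * ∑ k ∈ Finset.Icc 1 T, (flipEvent θ x x' l h k j).indicator 1 W := by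
  have hterm : ∀ k, (((layerSpikes 1 θ W x l h k j : ℤ) : ℝ)
      - ((layerSpikes 1 θ W x' l h k j : ℤ) : ℝ)) ^ 2
      ≤ 4 * (flipEvent θ x x' l h k j).indicator (1 : Weights N L → ℝ) W := by
    intro k
    by_cases hk : layerSpikes 1 θ W x l h k j = layerSpikes 1 θ W x' l h k j
    · rw [hk, sub_self]
      have : 0 ≤ (flipEvent θ x x' l h k j).indicator (1 : Weights N L → ℝ) W :=
        Set.indicator_nonneg (fun _ _ => zero_le_one) W
      linarith
    · rw [Set.indicator_of_mem (show W ∈ flipEvent θ x x' l h k j from hk)]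
      rcases Int.units_eq_one_or (layerSpikes 1 θ W x l h k j) with h1 | h1 <;>
        rcases Int.units_eq_one_or (layerSpikes 1 θ W x' l h k j) with h2 | h2 <;>
        rw [h1, h2] <;> norm_num
  have hnn : ∀ k, 0 ≤ (flipEvent θ x x' l h k j).indicator (1 : Weights N L → ℝ) W := fun k =>
    Set.indicator_nonneg (fun _ _ => zero_le_one) W
  rw [← Finset.sum_sub_distrib]
  refine sq_sum_le_card_mul_sum_sq.trans ?_
  rw [Nat.card_Icc, Nat.add_sub_cancel]
  have h1 : ∑ k ∈ Finset.Icc 1 s, (((layerSpikes 1 θ W x l h k j : ℤ) : ℝ)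
      - ((layerSpikes 1 θ W x' l h k j : ℤ) : ℝ)) ^ 2
      ≤ 4 * ∑ k ∈ Finset.Icc 1 T, (flipEvent θ x x' l h k j).indicator (1 : Weights N L → ℝ) W := by
    rw [Finset.mul_sum]
    refine (Finset.sum_le_sum fun k _ => hterm k).trans ?_
    exact Finset.sum_le_sum_of_subset_of_nonneg (Finset.Icc_subset_Icc_right hs)
      fun k _ _ => mul_nonneg (by norm_num) (hnn k)
  calc (s : ℝ) * _ ≤ T * (4 * ∑ k ∈ Finset.Icc 1 T,
        (flipEvent θ x x' l h k j).indicator (1 : Weights N L → ℝ) W) := by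
        gcongr
    _ = _ := by ring

theorem integral_sum_indicator_flipEvent (n : ℕ) (θ : ℝ) (T : ℕ) {N : ℕ → ℕ} {L : ℕ}
    (x x' : ℕ → Cube (N 0)) (l : ℕ) (h : l ≤ L) :
    Integrable (fun W => ∑ j, ∑ k ∈ Finset.Icc 1 T,
        (flipEvent θ x x' l h k j).indicator (1 : Weights N L → ℝ) W) (gaussianInit n N L) ∧
      ∫ W, ∑ j, ∑ k ∈ Finset.Icc 1 T, (flipEvent θ x x' l h k j).indicator 1 W
        ∂gaussianInit n N L = expectedFlips n θ T x x' l h := by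
  have hint : ∀ j k, Integrable ((flipEvent θ x x' l h k j).indicator (1 : Weights N L → ℝ))
      (gaussianInit n N L) := fun j k =>
    (integrable_const 1).indicator (measurableSet_flipEvent θ x x' l h k j)
  refine ⟨integrable_finsetSum _ fun j _ => integrable_finsetSum _ fun k _ => hint j k, ?_⟩
  rw [integral_finsetSum _ fun j _ => integrable_finsetSum _ fun k _ => hint j k]
  refine Finset.sum_congr rfl fun j _ => ?_
  rw [integral_finsetSum _ fun k _ => hint j k]
  exact Finset.sum_congr rfl fun k _ => integral_indicator_one (measurableSet_flipEvent θ x x' l h k j)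

/-- The accumulated input of neuron `i` of layer `l + 1`, as a linear form in its weights. -/
theorem sum_layerSpikes_eq (θ : ℝ) {N : ℕ → ℕ} {L : ℕ} (W : Weights N L) (x : ℕ → Cube (N 0))
    (l : ℕ) (h : l ≤ L) (w : Fin (N l) → ℝ) (s : ℕ) :
    ∑ k ∈ Finset.Icc 1 s, ∑ j, w j * ((layerSpikes 1 θ W x l h k j : ℤ) : ℝ)
      = ∑ j, w j * ∑ k ∈ Finset.Icc 1 s, ((layerSpikes 1 θ W x l h k j : ℤ) : ℝ) := by
  rw [Finset.sum_comm]
  simp only [Finset.mul_sum]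

/-- Flips are propagated from one layer to the next in a controlled way. -/
theorem measureReal_flipEvent_succ_le {n : ℕ} {θ : ℝ} (hθ : 0 < θ) {T : ℕ} {N : ℕ → ℕ} {L : ℕ}
    (x x' : ℕ → Cube (N 0)) (l : ℕ) (h : l + 1 ≤ L) {k : ℕ} (hk : k ≤ T) (i : Fin (N (l + 1)))
    {r : ℝ} (hr : 0 < r) :
    (gaussianInit n N L).real (flipEvent θ x x' (l + 1) h k i) ≤
      (T + 1) ^ 2 * (4 * T * (expectedFlips n θ T x x' l (Nat.le_of_succ_le h) / n) / r ^ 2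
        + 2 * r / θ) := by
  set hl := Nat.le_of_succ_le h
  let m₀ : Fin L := ⟨l, h⟩
  let p : (ℕ → Cube (N 0)) → ℕ → Weights N L → Fin (N l) → ℝ := fun y s W j =>
    ∑ k ∈ Finset.Icc 1 s, ((layerSpikes 1 θ W y l hl k j : ℤ) : ℝ)
  have hp : ∀ y s j, Measurable fun W => p y s W j := fun y s j =>
    Finset.measurable_sum _ fun k _ => (measurable_of_countable fun u : ℤˣ => ((u : ℤ) : ℝ)).comp
      (measurable_layerSpikes 1 θ y l hl k j)
  -- The straddling event, with the neuron's incoming weights split off as a separate variable so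
  -- that they can be integrated while the layers below stay fixed.
  let E : ℕ → ℕ → Set (Weights N L × (Fin (N l) → ℝ)) := fun s m =>
    {q | |∑ j, q.2 j * p x s q.1 j - (m + 1) * θ|
      ≤ |∑ j, q.2 j * p x s q.1 j - ∑ j, q.2 j * p x' s q.1 j|}
  have hE : ∀ s m, MeasurableSet (E s m) := by
    intro s m
    have hform : ∀ y, Measurable fun q : Weights N L × (Fin (N l) → ℝ) =>
        ∑ j, q.2 j * p y s q.1 j := fun y => Finset.measurable_sum _ fun j _ =>
      Measurable.mul (by fun_prop) ((hp y s j).comp measurable_fst)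
    have h1 := hform x
    have h2 := hform x'
    exact measurableSet_le (h1.sub_const _).abs (h1.sub h2).abs
  have hupd : ∀ s m W V w, ((Function.update W m₀ V, w) ∈ E s m ↔ (W, w) ∈ E s m) := by
    intro s m W V w
    have : ∀ y, p y s (Function.update W m₀ V) = p y s W := fun y => by
      ext j
      simp only [p, layerSpikes_update 1 θ W y m₀ V l hl le_rfl]
    simp only [E, Set.mem_ofPred_eq, this]
  obtain ⟨hint, hval⟩ := integral_sum_indicator_flipEvent n θ T x x' l hl (L := L)
  set F : Weights N L → ℝ := fun W => ∑ j, ∑ k ∈ Finset.Icc 1 T,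
    (flipEvent θ x x' l hl k j).indicator (1 : Weights N L → ℝ) W
  have hF0 : ∀ W, 0 ≤ F W := fun W => Finset.sum_nonneg fun j _ => Finset.sum_nonneg fun k _ =>
    Set.indicator_nonneg (fun _ _ => zero_le_one) W
  set B : ℝ := 4 * T * (expectedFlips n θ T x x' l hl / n) / r ^ 2 + 2 * r / θ with hB
  have hB0 : 0 ≤ B := by
    have : 0 ≤ expectedFlips n θ T x x' l hl := hval ▸ integral_nonneg hF0
    positivity
  have hbound : ∀ s ∈ Finset.range (T + 1), ∀ m : ℕ,
      (gaussianInit n N L).real {W | (W, W m₀ i) ∈ E s m} ≤ B := by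
    intro s hs m
    have hsT : s ≤ T := by have := Finset.mem_range.mp hs; omega
    -- The lowest level is the worst case, so one bound `B` serves all pairs `(s, m)`.
    have hm : θ ≤ (m + 1) * θ := le_mul_of_one_le_left hθ.le (by simp)
    refine ENNReal.toReal_le_of_le_ofReal hB0 ?_
    refine (gaussianInit_le_of_update m₀ i (hE s m) (hupd s m)
      (g := fun W => ENNReal.ofReal (4 * T * (F W / n) / r ^ 2 + 2 * r / θ)) fun W => ?_).trans_eq ?_
    · refine (pi_gaussianReal_abs_sub_le_abs _ (p x s W) (p x' s W) (by positivity) hr).trans ?_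
      refine ENNReal.ofReal_le_ofReal ?_
      have hsq : ∑ j, (p x s W j - p x' s W j) ^ 2 ≤ 4 * T * F W := by
        rw [Finset.mul_sum]
        exact Finset.sum_le_sum fun j _ => sum_layerSpikes_sub_sq_le θ W x x' l hl j hsT
      have : (∑ j, (p x s W j - p x' s W j) ^ 2) * (((n : NNReal)⁻¹ : NNReal) : ℝ)
          ≤ 4 * T * (F W / n) := by
        rw [NNReal.coe_inv, NNReal.coe_natCast, ← mul_div_assoc, div_eq_mul_inv]
        gcongr
      gcongr
    -- The conditional bound is affine in the flip count `F W`, so averaging just replaces it by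
    -- `expectedFlips`.
    · have hint2 : Integrable (fun W => 4 * T * (F W / n) / r ^ 2) (gaussianInit n N L) :=
        ((hint.div_const _).const_mul _).div_const _
      rw [← ofReal_integral_eq_lintegral_ofReal
        (f := fun W => 4 * T * (F W / n) / r ^ 2 + 2 * r / θ) (hint2.add (integrable_const _))
        (Filter.Eventually.of_forall fun W => by
          have := hF0 W
          simp only [Pi.zero_apply]
          positivity)]
      congr 1
      rw [integral_add hint2 (integrable_const _), integral_div, integral_const_mul, integral_div,
        hval]
      simp [hB]
  have hsub : flipEvent θ x x' (l + 1) h k i ⊆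
      ⋃ s ∈ Finset.range (T + 1), ⋃ m ∈ Finset.range (T + 1), {W | (W, W m₀ i) ∈ E s m} := by
    intro W hW
    obtain ⟨s, hs, m, hm, hle⟩ := exists_abs_sub_le_of_spike_ne hk hW
    rw [sum_layerSpikes_eq, sum_layerSpikes_eq] at hle
    exact Set.mem_biUnion hs (Set.mem_biUnion hm hle)
  calc (gaussianInit n N L).real (flipEvent θ x x' (l + 1) h k i)
      ≤ ∑ s ∈ Finset.range (T + 1), ∑ m ∈ Finset.range (T + 1),
          (gaussianInit n N L).real {W | (W, W m₀ i) ∈ E s m} :=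
        (measureReal_mono hsub (measure_ne_top _ _)).trans ((measureReal_biUnion_finset_le _ _).trans
          (Finset.sum_le_sum fun s _ => measureReal_biUnion_finset_le _ _))
    _ ≤ ∑ s ∈ Finset.range (T + 1), ∑ m ∈ Finset.range (T + 1), B :=
        Finset.sum_le_sum fun s hs => Finset.sum_le_sum fun m _ => hbound s hs m
    _ = (T + 1) ^ 2 * B := by simp; ring

theorem expectedFlips_succ_le {n : ℕ} {θ : ℝ} (hθ : 0 < θ) {T : ℕ} {N : ℕ → ℕ} {L : ℕ}
    (x x' : ℕ → Cube (N 0)) (l : ℕ) (h : l + 1 ≤ L) {r : ℝ} (hr : 0 < r) :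
    expectedFlips n θ T x x' (l + 1) h ≤ N (l + 1) * (T * ((T + 1) ^ 2 *
      (4 * T * (expectedFlips n θ T x x' l (Nat.le_of_succ_le h) / n) / r ^ 2 + 2 * r / θ))) := by
  refine (Finset.sum_le_sum fun i _ => Finset.sum_le_sum fun k hk =>
    measureReal_flipEvent_succ_le hθ x x' l h (Finset.mem_Icc.mp hk).2 i hr).trans_eq ?_
  simp

/-! ### Noise -/

theorem measureReal_prod_eq_integral {α β : Type*} [MeasurableSpace α] [MeasurableSpace β]
    (μ : Measure α) (ρ : Measure β) [IsFiniteMeasure μ] [IsFiniteMeasure ρ]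
    {s : Set (α × β)} (hs : MeasurableSet s) :
    (μ.prod ρ).real s = ∫ a, ρ.real (Prod.mk a ⁻¹' s) ∂μ := by
  rw [measureReal_def, Measure.prod_apply hs, ← integral_toReal]
  · rfl
  · exact (measurable_measure_prodMk_left hs).aemeasurable
  · exact Filter.Eventually.of_forall fun _ => measure_lt_top _ _

theorem measureReal_prod_eq_integral_symm {α β : Type*} [MeasurableSpace α] [MeasurableSpace β]
    (μ : Measure α) (ρ : Measure β) [IsFiniteMeasure μ] [IsFiniteMeasure ρ]
    {s : Set (α × β)} (hs : MeasurableSet s) :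
    (μ.prod ρ).real s = ∫ b, μ.real ((fun a => (a, b)) ⁻¹' s) ∂ρ := by
  rw [measureReal_def, Measure.prod_apply_symm hs, ← integral_toReal]
  · rfl
  · exact (measurable_measure_prodMk_right hs).aemeasurable
  · exact Filter.Eventually.of_forall fun _ => measure_lt_top _ _

instance (n : ℕ) : IsProbabilityMeasure (unifCube n) :=
  isProbabilityMeasure_uniformOn Set.finite_univ Set.univ_nonempty

instance (n : ℕ) (κ : unitInterval) : IsProbabilityMeasure (rad n κ) := by
  unfold rad; infer_instance

/-- Independently, a uniform point of the hypercube and a noise vector of rate `ν`. -/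
noncomputable abbrev noisePair (n : ℕ) (ν : unitInterval) : Measure (Cube n × Cube n) :=
  (unifCube n).prod (rad n (unitInterval.symm ν))

theorem integral_noisePair {n : ℕ} (ν : unitInterval) (g : Cube n → Cube n → ℝ) :
    ∫ q, g q.1 q.2 ∂noisePair n ν
      = ∫ ξ, (2 ^ n : ℝ)⁻¹ * ∑ x, g x ξ ∂rad n (unitInterval.symm ν) := by
  have hunif : ∀ x : Cube n, (unifCube n).real {x} = (2 ^ n : ℝ)⁻¹ := by
    intro x
    rw [measureReal_def, unifCube, uniformOn_univ]
    simp
  rw [integral_prod_symm _ .of_finite]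
  refine integral_congr_ae (Filter.Eventually.of_forall fun ξ => ?_)
  simp only
  rw [integral_fintype .of_finite, Finset.mul_sum]
  exact Finset.sum_congr rfl fun x _ => by rw [hunif, smul_eq_mul]

theorem integral_rad_eval {n : ℕ} (κ : unitInterval) (g : ℤˣ → ℝ) (i : Fin n) :
    ∫ ξ : Cube n, g (ξ i) ∂rad n κ = κ * g 1 + (1 - κ) * g (-1) := by
  have h := (measurePreserving_eval (fun _ : Fin n => bernoulliMeasure (1 : ℤˣ) (-1) κ) i)
  have h2 := integral_map (μ := rad n κ) (φ := fun ξ : Cube n => ξ i) (f := g)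
    (measurable_pi_apply i).aemeasurable (measurable_of_countable g).aestronglyMeasurable
  have h3 : (rad n κ).map (fun ξ : Cube n => ξ i) = bernoulliMeasure (1 : ℤˣ) (-1) κ := h.map_eq
  rw [← h2, h3, integral_bernoulliMeasure]
  simp

/-! ### Fourier side: noise sensitivity and high-degree weight. -/

theorem integral_rad_walsh {n : ℕ} (κ : unitInterval) (S : Finset (Fin n)) :
    ∫ ξ, walsh S ξ ∂rad n κ = (2 * κ - 1 : ℝ) ^ S.card := by
  have h1 : ∀ ξ : Cube n, walsh S ξ = ∏ i, if i ∈ S then ((ξ i : ℤ) : ℝ) else 1 := fun ξ => by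
    rw [walsh, Finset.prod_ite_mem, Finset.univ_inter]
  simp only [h1]
  rw [rad, integral_fintype_prod_eq_prod (fun i (u : ℤˣ) => if i ∈ S then ((u : ℤ) : ℝ) else 1)]
  have h2 : ∀ i, ∫ u : ℤˣ, (if i ∈ S then ((u : ℤ) : ℝ) else 1)
      ∂bernoulliMeasure (1 : ℤˣ) (-1) κ = if i ∈ S then (2 * κ - 1 : ℝ) else 1 := by
    intro i
    rw [integral_bernoulliMeasure]
    split_ifs
    · simp; ring
    · simp
  rw [Finset.prod_congr rfl fun i _ => h2 i, Finset.prod_ite_mem, Finset.univ_inter,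
    Finset.prod_const]

theorem walsh_mul {n : ℕ} (S : Finset (Fin n)) (x y : Cube n) :
    walsh S (x * y) = walsh S x * walsh S y := by
  simp [walsh, Finset.prod_mul_distrib]

/-- Characters diagonalise translations: shifting by `ξ` multiplies the coefficient at `S` by `walsh
S ξ`. The case `ξ = 1` is Parseval. -/
theorem mean_mul_shift {n : ℕ} (g : Cube n → ℝ) (ξ : Cube n) :
    (2 ^ n : ℝ)⁻¹ * ∑ x, g x * g (x * ξ) = ∑ S, walshCoeff g S ^ 2 * walsh S ξ := by
  have : ∀ x, g x * g (x * ξ) = ∑ S, walshCoeff g S * walsh S ξ * (g x * walsh S x) := fun x => by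
    rw [walsh_expansion g (x * ξ), Finset.mul_sum]
    exact Finset.sum_congr rfl fun S _ => by rw [walsh_mul]; ring
  simp only [this]
  rw [Finset.sum_comm, Finset.mul_sum]
  refine Finset.sum_congr rfl fun S _ => ?_
  rw [← Finset.mul_sum]
  conv_rhs => rw [sq]
  nth_rw 3 [walshCoeff]
  ring

/-- The noise sensitivity of a sign-valued function in terms of its Fourier-Walsh coefficients. -/
theorem noiseSensitivity_eq {n : ℕ} (ν : unitInterval) (g : Cube n → ℝ)
    (hg : ∀ x, g x = 1 ∨ g x = -1) :
    (noisePair n ν).real {q | g q.1 ≠ g (q.1 * q.2)}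
      = 1 / 2 * ∑ S, walshCoeff g S ^ 2 * (1 - (1 - 2 * ν : ℝ) ^ S.card) := by
  have hparseval : ∑ S, walshCoeff g S ^ 2 = 1 := by
    have h := mean_mul_shift g 1
    have hw : ∀ S : Finset (Fin n), walsh S (1 : Cube n) = 1 := fun S => by simp [walsh]
    have hsq : ∀ x, g x * g x = 1 := fun x => by rcases hg x with h | h <;> rw [h] <;> norm_num
    simp only [mul_one, hw, hsq] at h
    rw [← h]
    simp
  -- For signs, disagreement is `(1 - product) / 2`, which turns the probability into a correlation.
  have hind : ∀ q : Cube n × Cube n, {q : Cube n × Cube n | g q.1 ≠ g (q.1 * q.2)}.indicator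
      (1 : Cube n × Cube n → ℝ) q = 1 / 2 - 1 / 2 * (g q.1 * g (q.1 * q.2)) := by
    intro q
    by_cases h : g q.1 = g (q.1 * q.2)
    · rw [Set.indicator_of_notMem (by simpa using h), ← h]
      rcases hg q.1 with h | h <;> rw [h] <;> norm_num
    · rw [Set.indicator_of_mem (by simpa using h)]
      rcases hg q.1 with h1 | h1 <;> rcases hg (q.1 * q.2) with h2 | h2 <;>
        first | exact absurd (h1.trans h2.symm) h | (rw [h1, h2]; norm_num)
  rw [← integral_indicator_one (Set.toFinite _).measurableSet]
  simp only [hind]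
  rw [integral_sub (integrable_const _) .of_finite, integral_const_mul,
    integral_noisePair ν fun x ξ => g x * g (x * ξ)]
  simp only [mean_mul_shift]
  rw [integral_finsetSum _ fun S _ => .of_finite]
  simp only [integral_const_mul, integral_rad_walsh, mul_sub, Finset.sum_sub_distrib, mul_one,
    hparseval, unitInterval.coe_symm_eq]
  simp
  refine Finset.sum_congr rfl fun S _ => ?_
  ring

/-- High-degree Fourier-Walsh weight is controlled by noise sensitivity. -/
theorem sum_walshCoeff_sq_le_noiseSensitivity {n : ℕ} (ν : unitInterval) (hν : 0 < (ν : ℝ))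
    (hν' : (ν : ℝ) ≤ 1 / 2) (g : Cube n → ℝ) (hg : ∀ x, g x = 1 ∨ g x = -1) :
    ∑ S : Finset (Fin n) with 1 / (ν : ℝ) < (S.card : ℝ), walshCoeff g S ^ 2
      ≤ 4 * (noisePair n ν).real {q | g q.1 ≠ g (q.1 * q.2)} := by
  rw [noiseSensitivity_eq ν g hg]
  have h0 : (0 : ℝ) ≤ 1 - 2 * ν := by linarith
  have h1 : (1 - 2 * ν : ℝ) ≤ 1 := by linarith
  have hterm : ∀ S : Finset (Fin n), 0 ≤ walshCoeff g S ^ 2 * (1 - (1 - 2 * ν : ℝ) ^ S.card) :=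
    fun S => mul_nonneg (sq_nonneg _) (sub_nonneg.mpr (pow_le_one₀ h0 h1))
  rw [← mul_assoc]
  refine le_trans ?_ (mul_le_mul_of_nonneg_left (Finset.sum_le_sum_of_subset_of_nonneg
    (Finset.filter_subset (fun S : Finset (Fin n) => 1 / (ν : ℝ) < (S.card : ℝ)) Finset.univ)
    fun S _ _ => hterm S) (by norm_num))
  rw [Finset.mul_sum]
  refine Finset.sum_le_sum fun S hS => ?_
  have hS' := (Finset.mem_filter.mp hS).2
  rw [div_lt_iff₀ hν] at hS'
  -- Here `S.card * ν > 1`. The weight at `S` thus enters the sensitivity with factor at least `1 /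
  -- 2 * (1 - 1 / 2)`, whence the constant `4`.
  have hpow : (1 - 2 * ν : ℝ) ^ S.card ≤ 1 / 2 := by
    calc (1 - 2 * ν : ℝ) ^ S.card ≤ Real.exp (-(2 * ν)) ^ S.card := by
          gcongr
          linarith [Real.add_one_le_exp (-(2 * ν : ℝ))]
      _ = Real.exp (-(2 * (S.card * ν))) := by rw [← Real.exp_nat_mul]; congr 1; ring
      _ ≤ Real.exp (-1) := Real.exp_le_exp.mpr (by linarith)
      _ ≤ 1 / 2 := by
          rw [Real.exp_neg, inv_eq_one_div]
          apply one_div_le_one_div_of_le (by norm_num)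
          linarith [Real.add_one_le_exp 1]
  nlinarith [sq_nonneg (walshCoeff g S)]

/-! ### Noise propagation through the network -/

/-- The input is static, so a flipped coordinate counts once for each of the `T` times. -/
theorem expectedFlips_zero (n : ℕ) (θ : ℝ) (T : ℕ) {N : ℕ → ℕ} {L : ℕ} (x ξ : Cube (N 0)) :
    expectedFlips n θ T (L := L) (fun _ => x) (fun _ => x * ξ) 0 (Nat.zero_le L)
      = T * ∑ j, if ξ j = 1 then (0 : ℝ) else 1 := by
  rw [expectedFlips, Finset.mul_sum]
  refine Finset.sum_congr rfl fun j _ => ?_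
  have hset : ∀ k, flipEvent θ (L := L) (fun _ => x) (fun _ => x * ξ) 0 (Nat.zero_le L) k j
      = {W | ξ j ≠ 1} := fun k => by
    ext W
    simp [flipEvent, layerSpikes]
  simp only [hset, Finset.sum_const, Nat.card_Icc, Nat.add_sub_cancel, nsmul_eq_mul]
  split_ifs with h <;> simp [h]

/-- The constant in the bound for the flips of layer `l`. -/
noncomputable def flipConst (T : ℕ) (θ : ℝ) : ℕ → ℝ
  | 0 => T
  | l + 1 => T * ((T + 1) ^ 2 * (4 * T * flipConst T θ l + 2 / θ))

theorem flipConst_nonneg (T : ℕ) {θ : ℝ} (hθ : 0 < θ) (l : ℕ) : 0 ≤ flipConst T θ l := by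
  induction l with
  | zero => simp [flipConst]
  | succ l ih => rw [flipConst]; positivity

/-- The expected number of spikes of layer `l` flipped by input noise of rate at most
`c ^ 4 ^ L`. -/
theorem integral_expectedFlips_le {n : ℕ} (hn : 0 < n) {θ : ℝ} (hθ : 0 < θ) (T : ℕ) {N : ℕ → ℕ}
    {L : ℕ} (hN : ∀ l < L, N l = n) (ν : unitInterval) {c : ℝ} (hc : 0 < c) (hc1 : c ≤ 1)
    (hν : (ν : ℝ) ≤ c ^ 4 ^ L) (l : ℕ) (h : l ≤ L) :
    ∫ q, expectedFlips n θ T (fun _ => q.1) (fun _ => q.1 * q.2) l h ∂noisePair (N 0) ν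
      ≤ N l * (flipConst T θ l * c ^ 4 ^ (L - l)) := by
  induction l with
  | zero =>
    simp only [expectedFlips_zero]
    rw [integral_noisePair ν fun _ ξ => T * ∑ j, if ξ j = 1 then (0 : ℝ) else 1]
    have : ∀ ξ : Cube (N 0), (2 ^ N 0 : ℝ)⁻¹ * ∑ _x : Cube (N 0),
        T * (∑ j, if ξ j = 1 then (0 : ℝ) else 1) = T * ∑ j, if ξ j = 1 then (0 : ℝ) else 1 := by
      intro ξ
      simp
    simp only [this]
    rw [integral_const_mul, integral_finsetSum _ fun j _ => .of_finite]
    simp only [integral_rad_eval _ fun u : ℤˣ => if u = 1 then (0 : ℝ) else 1]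
    simp only [unitInterval.coe_symm_eq, flipConst, Nat.sub_zero]
    have h1 : (-1 : ℤˣ) ≠ 1 := by decide
    simp only [h1, if_true, if_false, Finset.sum_const, Finset.card_univ, Fintype.card_fin,
      nsmul_eq_mul]
    calc (T : ℝ) * (N 0 * ((1 - ν) * 0 + (1 - (1 - ν)) * 1)) = N 0 * (T * ν) := by ring
      _ ≤ N 0 * (T * c ^ 4 ^ L) := by gcongr
  | succ l ih =>
    have hl := Nat.le_of_succ_le h
    specialize ih hl
    rw [hN l h] at ih
    -- This radius makes the flip fraction below of order `r ^ 4`; the Chebyshev term is then of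
    -- order `r ^ 2 ≤ r`, comparable with the small-ball term.
    set r := c ^ 4 ^ (L - (l + 1)) with hr
    have hr0 : 0 < r := by positivity
    have hr1 : r ≤ 1 := pow_le_one₀ hc.le hc1
    have hr4 : c ^ 4 ^ (L - l) = r ^ 4 := by
      rw [hr, ← pow_mul, ← pow_succ]
      congr 2
      omega
    rw [hr4] at ih
    set A := ∫ q, expectedFlips n θ T (fun _ => q.1) (fun _ => q.1 * q.2) l hl ∂noisePair (N 0) ν
    have hn' : (0 : ℝ) < n := by exact_mod_cast hn
    have hK := flipConst_nonneg T hθ l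
    have hstep : ∫ q, expectedFlips n θ T (fun _ => q.1) (fun _ => q.1 * q.2) (l + 1) h
        ∂noisePair (N 0) ν ≤ N (l + 1) * (T * ((T + 1) ^ 2 *
          (4 * T * (A / n) / r ^ 2 + 2 * r / θ))) := by
      refine (integral_mono .of_finite .of_finite fun q =>
        expectedFlips_succ_le hθ _ _ l h hr0).trans_eq ?_
      rw [integral_const_mul, integral_const_mul, integral_const_mul,
        integral_add .of_finite .of_finite, integral_div, integral_const_mul, integral_div]
      simp [A]
    have hA : A / n / r ^ 2 ≤ flipConst T θ l * r := by
      rw [div_div, div_le_iff₀ (by positivity)]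
      calc A ≤ n * (flipConst T θ l * r ^ 4) := ih
        _ = (n * flipConst T θ l * r ^ 3) * r := by ring
        _ ≤ (n * flipConst T θ l * r ^ 3) * 1 := by gcongr
        _ = _ := by ring
    refine hstep.trans ?_
    rw [flipConst]
    calc (N (l + 1) : ℝ) * (T * ((T + 1) ^ 2 * (4 * T * (A / n) / r ^ 2 + 2 * r / θ)))
        = N (l + 1) * (T * ((T + 1) ^ 2 * (4 * T * (A / n / r ^ 2) + 2 * r / θ))) := by ring
      _ ≤ N (l + 1) * (T * ((T + 1) ^ 2 * (4 * T * (flipConst T θ l * r) + 2 * r / θ))) := by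
          gcongr
      _ = _ := by ring

/-! ### The classifier -/

theorem measurable_staticClassifier (β θ : ℝ) (T : ℕ) {N : ℕ → ℕ} {L : ℕ}
    (sel : (Fin (N L) → ℤ) → Fin (N L)) (x : Cube (N 0)) :
    Measurable fun W : Weights N L => staticClassifier β θ T sel W x := by
  refine (measurable_of_countable sel).comp (measurable_pi_iff.mpr fun i => ?_)
  exact Finset.measurable_sum _ fun t _ => (measurable_of_countable fun u : ℤˣ => (u : ℤ)).comp
    (measurable_layerSpikes β θ _ L le_rfl t i)

theorem measurableSet_staticClassifier_ne (β θ : ℝ) (T : ℕ) {N : ℕ → ℕ} {L : ℕ}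
    (sel : (Fin (N L) → ℤ) → Fin (N L)) :
    MeasurableSet {p : Weights N L × Cube (N 0) × Cube (N 0) |
      staticClassifier β θ T sel p.1 p.2.1 ≠ staticClassifier β θ T sel p.1 (p.2.1 * p.2.2)} := by
  have hset : {p : Weights N L × Cube (N 0) × Cube (N 0) |
      staticClassifier β θ T sel p.1 p.2.1 ≠ staticClassifier β θ T sel p.1 (p.2.1 * p.2.2)}
      = ⋃ q : Cube (N 0) × Cube (N 0), {W | staticClassifier β θ T sel W q.1
          ≠ staticClassifier β θ T sel W (q.1 * q.2)} ×ˢ {q} := by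
    ext ⟨W, q⟩
    simp [Set.mem_iUnion]
  rw [hset]
  exact MeasurableSet.iUnion fun q => (measurableSet_eq_fun (measurable_staticClassifier _ _ _ _ _)
    (measurable_staticClassifier _ _ _ _ _)).compl.prod (measurableSet_singleton q)

/-- The label depends only on the output spikes, so a changed label forces a flip in the last layer,
and a union bound applies. -/
theorem ENS_staticClassifier_le {n : ℕ} (hn : 0 < n) {θ : ℝ} (hθ : 0 < θ) (T : ℕ) {N : ℕ → ℕ}
    {L : ℕ} (hN : ∀ l < L, N l = n) (sel : (Fin (N L) → ℤ) → Fin (N L)) (ν : unitInterval)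
    {c : ℝ} (hc : 0 < c) (hc1 : c ≤ 1) (hν : (ν : ℝ) ≤ c ^ 4 ^ L) :
    ENS ν (gaussianInit n N L) (staticClassifier 1 θ T sel) ≤ N L * (flipConst T θ L * c) := by
  rw [ENS, measureReal_prod_eq_integral_symm _ _ (measurableSet_staticClassifier_ne 1 θ T sel)]
  have h := integral_expectedFlips_le hn hθ T hN ν hc hc1 hν L le_rfl
  rw [Nat.sub_self, pow_zero, pow_one] at h
  refine (integral_mono .of_finite .of_finite fun q => ?_).trans h
  have hsub : (fun W : Weights N L => (W, q)) ⁻¹' {p |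
      staticClassifier 1 θ T sel p.1 p.2.1 ≠ staticClassifier 1 θ T sel p.1 (p.2.1 * p.2.2)}
      ⊆ ⋃ j, ⋃ k ∈ Finset.Icc 1 T,
        flipEvent θ (fun _ => q.1) (fun _ => q.1 * q.2) L le_rfl k j := by
    intro W hW
    by_contra hcon
    simp only [Set.mem_iUnion, not_exists, flipEvent, Set.mem_ofPred_eq, not_not] at hcon
    refine hW (congrArg sel (funext fun j => Finset.sum_congr rfl fun k hk => ?_))
    rw [hcon j k hk]
  refine (measureReal_mono hsub (measure_ne_top _ _)).trans ?_
  exact (measureReal_iUnion_fintype_le _).trans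
    (Finset.sum_le_sum fun j _ => measureReal_biUnion_finset_le _ _)

theorem labelSign_eq_or {m : ℕ} (i : Fin m) : labelSign i = 1 ∨ labelSign i = -1 := by
  unfold labelSign
  split_ifs
  · exact Or.inl rfl
  · exact Or.inr rfl

/-- The expected spectrum of the classifier is concentrated up to degree `1 / ν` once its expected
noise sensitivity at rate `ν` is small. -/
theorem expectedSpectrumConcentrated_of_ENS_le {n : ℕ} {θ : ℝ} {T : ℕ} {N : ℕ → ℕ}
    {L : ℕ} (sel : (Fin (N L) → ℤ) → Fin (N L)) (ν : unitInterval) (hν : 0 < (ν : ℝ))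
    (hν' : (ν : ℝ) ≤ 1 / 2) {ε : ℝ}
    (hε : 4 * ENS ν (gaussianInit n N L) (staticClassifier 1 θ T sel) ≤ ε) :
    ExpectedSpectrumConcentrated (gaussianInit n N L)
      (fun W x => labelSign (staticClassifier 1 θ T sel W x)) ε (1 / (ν : ℝ)) := by
  set F : Weights N L → ℝ := fun W => ∑ S : Finset (Fin (N 0)) with 1 / (ν : ℝ) < (S.card : ℝ),
    walshCoeff (fun x => labelSign (staticClassifier 1 θ T sel W x)) S ^ 2 with hF
  set E := {p : Weights N L × Cube (N 0) × Cube (N 0) |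
    staticClassifier 1 θ T sel p.1 p.2.1 ≠ staticClassifier 1 θ T sel p.1 (p.2.1 * p.2.2)}
  have hE : MeasurableSet E := measurableSet_staticClassifier_ne 1 θ T sel
  -- The Fourier bound holds for each fixed network; integrating over `W` by Fubini gives `ENS`.
  have hle : ∀ W, F W ≤ 4 * (noisePair (N 0) ν).real (Prod.mk W ⁻¹' E) := by
    intro W
    refine (sum_walshCoeff_sq_le_noiseSensitivity ν hν hν' _ fun x => labelSign_eq_or _).trans ?_
    refine mul_le_mul_of_nonneg_left (measureReal_mono ?_ (measure_ne_top _ _)) (by norm_num)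
    exact fun q hq heq => hq (congrArg labelSign heq)
  have hF0 : ∀ W, 0 ≤ F W := fun W => Finset.sum_nonneg fun S _ => sq_nonneg _
  have hFm : Measurable F := Finset.measurable_sum _ fun S _ => by
    refine Measurable.pow_const (Measurable.const_mul (Finset.measurable_sum _ fun x _ =>
      Measurable.mul_const ?_ _) _) _
    exact (measurable_of_countable labelSign).comp (measurable_staticClassifier _ _ _ _ _)
  have hFi : Integrable F (gaussianInit n N L) := by
    refine Integrable.of_bound hFm.aestronglyMeasurable 4 (Filter.Eventually.of_forall fun W => ?_)
    rw [Real.norm_of_nonneg (hF0 W)]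
    have : (noisePair (N 0) ν).real (Prod.mk W ⁻¹' E) ≤ 1 := measureReal_le_one
    linarith [hle W]
  have hGi : Integrable (fun W => (noisePair (N 0) ν).real (Prod.mk W ⁻¹' E))
      (gaussianInit n N L) := by
    refine Integrable.of_bound (measurable_measure_prodMk_left hE).ennreal_toReal.aestronglyMeasurable
      1 (Filter.Eventually.of_forall fun W => ?_)
    rw [Real.norm_of_nonneg measureReal_nonneg]
    exact measureReal_le_one
  refine ⟨hFi, le_trans ?_ hε⟩
  rw [ENS, measureReal_prod_eq_integral _ _ hE, ← integral_const_mul]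
  exact integral_mono hFi (hGi.const_mul 4) hle

/-! ### Absorbing the constants, and the conclusion. -/

/-- Admissible noise rates are eventually small compared with any constant. -/
theorem exists_mul_rpow_le {K p : ℝ} (hK : 0 ≤ K) (hp : 0 < p) :
    ∃ n₀ : ℕ, ∀ n ≥ n₀, ∀ ν : ℝ, 0 ≤ ν → ν ≤ 1 / Real.sqrt (n * Real.log n) →
      3 ≤ n ∧ ν ≤ 1 / 2 ∧ K * ν ^ p ≤ 1 := by
  have hlim : Filter.Tendsto (fun n : ℕ => 1 / Real.sqrt (n * Real.log n)) Filter.atTop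
      (nhds 0) := by
    simp only [one_div]
    refine Filter.Tendsto.inv_tendsto_atTop (Real.tendsto_sqrt_atTop.comp ?_)
    exact Filter.Tendsto.atTop_mul_atTop₀ tendsto_natCast_atTop_atTop
      (Real.tendsto_log_atTop.comp tendsto_natCast_atTop_atTop)
  have hlim2 : Filter.Tendsto (fun n : ℕ => K * (1 / Real.sqrt (n * Real.log n)) ^ p)
      Filter.atTop (nhds 0) := by
    have h := (hlim.rpow_const (p := p) (Or.inr hp.le)).const_mul K
    rwa [Real.zero_rpow hp.ne', mul_zero] at h
  obtain ⟨n₀, h⟩ := Filter.eventually_atTop.mp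
    ((hlim.eventually_le_const (by norm_num : (0 : ℝ) < 1 / 2)).and
      ((hlim2.eventually_le_const one_pos).and (Filter.eventually_ge_atTop 3)))
  refine ⟨n₀, fun n hn ν hν0 hν => ⟨(h n hn).2.2, hν.trans (h n hn).1, ?_⟩⟩
  refine le_trans ?_ (h n hn).2.1
  gcongr

/-- In the range of admissible noise rates, the expected noise sensitivity of the classifier is
bounded by the power `1 / 2 ^ (2 L + 1)` of the noise rate, which is worse than the power
`1 / 4 ^ L` that the propagation of flips yields, and so absorbs all constants. -/
theorem four_mul_ENS_staticClassifier_le {n : ℕ} (hn : 0 < n) {θ : ℝ} (hθ : 0 < θ) (T : ℕ)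
    {N : ℕ → ℕ} {L : ℕ} (hN : ∀ l < L, N l = n) (sel : (Fin (N L) → ℤ) → Fin (N L))
    (ν : unitInterval) (hν : 0 < (ν : ℝ))
    (hsmall : 4 * N L * flipConst T θ L * (ν : ℝ) ^ (1 / (2 : ℝ) ^ (2 * L + 1)) ≤ 1) :
    4 * ENS ν (gaussianInit n N L) (staticClassifier 1 θ T sel)
      ≤ (ν : ℝ) ^ (1 / (2 : ℝ) ^ (2 * L + 1)) := by
  set a := (ν : ℝ) ^ (1 / (2 : ℝ) ^ (2 * L + 1)) with ha
  have ha0 : 0 < a := by positivity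
  have ha1 : a ≤ 1 := Real.rpow_le_one hν.le ν.2.2 (by positivity)
  -- Flip propagation is applied with `c = a ^ 2`: one factor `a` is the target, the other is spent
  -- on the constants through `hsmall`.
  have hpow : (ν : ℝ) = (a ^ 2) ^ 4 ^ L := by
    rw [ha, ← Real.rpow_natCast, ← Real.rpow_natCast, ← Real.rpow_mul hν.le, ← Real.rpow_mul hν.le]
    have : 1 / (2 : ℝ) ^ (2 * L + 1) * ((2 : ℕ) : ℝ) * ((4 ^ L : ℕ) : ℝ) = 1 := by
      push_cast
      rw [show (4 : ℝ) = 2 ^ 2 by norm_num, ← pow_mul, pow_succ]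
      field_simp
    rw [this, Real.rpow_one]
  have h := ENS_staticClassifier_le hn hθ T hN sel ν (c := a ^ 2) (by positivity)
    (pow_le_one₀ ha0.le ha1) hpow.le
  calc 4 * ENS ν (gaussianInit n N L) (staticClassifier 1 θ T sel)
      ≤ 4 * (N L * (flipConst T θ L * a ^ 2)) := by gcongr
    _ = (4 * N L * flipConst T θ L * a) * a := by ring
    _ ≤ 1 * a := by gcongr
    _ = a := one_mul a

/-- Without noise there is no noise sensitivity. -/
theorem ENS_zero {Ω α : Type*} [MeasurableSpace Ω] {n : ℕ} (μ : Measure Ω) [IsFiniteMeasure μ]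
    (f : Ω → Cube n → α) : ENS 0 μ f = 0 := by
  have hdirac : rad n (unitInterval.symm 0) = Measure.dirac 1 := by
    rw [rad, unitInterval.symm_zero, bernoulliMeasure_one]
    refine Measure.pi_eq fun s hs => ?_
    rw [Measure.dirac_apply' _ (MeasurableSet.univ_pi hs)]
    simp only [Measure.dirac_apply' _ (hs _)]
    by_cases h : ∀ i, (1 : ℤˣ) ∈ s i
    · rw [Set.indicator_of_mem (show (1 : Cube n) ∈ Set.univ.pi s from fun i _ => h i)]
      simp [h]
    · rw [Set.indicator_of_notMem
        (show (1 : Cube n) ∉ Set.univ.pi s from fun hmem => h fun i => hmem i trivial)]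
      push Not at h
      obtain ⟨i, hi⟩ := h
      exact (Finset.prod_eq_zero (Finset.mem_univ i) (Set.indicator_of_notMem hi _)).symm
  have hnull : (μ.prod ((unifCube n).prod (rad n (unitInterval.symm 0))))
      (Set.univ ×ˢ (Set.univ ×ˢ {1}ᶜ)) = 0 := by
    rw [Measure.prod_prod, Measure.prod_prod, hdirac, Measure.dirac_apply]
    simp
  rw [ENS, measureReal_def, measure_mono_null ?_ hnull, ENNReal.toReal_zero]
  rintro ⟨w, x, ξ⟩ hp
  refine ⟨trivial, trivial, fun h => hp ?_⟩
  rw [Set.mem_singleton_iff] at h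
  simp only at h
  simp only [h, mul_one]

theorem corollary1 :
    ∃ C > (0 : ℝ), ∃ c > (0 : ℝ),
      ∀ (L T : ℕ) (θ : ℝ), 1 ≤ L → 1 ≤ T → 0 < θ →
        ∃ n₀ : ℕ, ∀ n ≥ n₀, ∀ N : ℕ → ℕ, (∀ l < L, N l = n) → N L = 2 →
          ∀ sel : (Fin (N L) → ℤ) → Fin (N L), IsArgmaxRule sel →
            ∀ ν : unitInterval, (ν : ℝ) ≤ 1 / Real.sqrt (n * Real.log n) →
              ENS ν (gaussianInit n N L) (staticClassifier 1 θ T sel) ≤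
                  2 * (T : ℝ) ^ 4 * C * (1 + θ) * (ν : ℝ) ^ (1 / (2 : ℝ) ^ (2 * L + 1))
                      * Real.log n ^ (3 / 2 : ℝ)
                    + ((L : ℝ) - 1) * Real.exp (-c * (ν : ℝ) ^ (1 / (2 : ℝ) ^ (2 * L - 1)) * n)
                    + Real.exp (-(1 / 4) * Real.sqrt n) ∧
              (0 < (ν : ℝ) →
                ExpectedSpectrumConcentrated (gaussianInit n N L)
                  (fun W x => labelSign (staticClassifier 1 θ T sel W x))
                  (2 * (T : ℝ) ^ 4 * C * (1 + θ) * (ν : ℝ) ^ (1 / (2 : ℝ) ^ (2 * L + 1))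
                    * Real.log n ^ (3 / 2 : ℝ))
                  (1 / (ν : ℝ))) := by
  -- Both constants can be `1`, since `n₀` may depend on `L`, `T`, `θ`. The exponential terms are
  -- nonnegative and are simply added at the end.
  refine ⟨1, one_pos, 1, one_pos, fun L T θ hL hT hθ => ?_⟩
  -- The `4` pays for the spectral inequality, the `2` is the output width.
  obtain ⟨n₀, hn₀⟩ := exists_mul_rpow_le (K := 4 * 2 * flipConst T θ L)
    (p := 1 / (2 : ℝ) ^ (2 * L + 1)) (by have := flipConst_nonneg T hθ L; positivity)
    (by positivity)
  refine ⟨n₀, fun n hn N hN hN2 sel _ ν hν => ?_⟩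
  obtain ⟨hn3, hhalf, hsmall⟩ := hn₀ n hn ν ν.2.1 hν
  set a := (ν : ℝ) ^ (1 / (2 : ℝ) ^ (2 * L + 1))
  have ha0 : 0 ≤ a := Real.rpow_nonneg ν.2.1 _
  have hlog : 1 ≤ Real.log n ^ (3 / 2 : ℝ) := by
    refine Real.one_le_rpow ?_ (by norm_num)
    have h3 : (3 : ℝ) ≤ n := by exact_mod_cast hn3
    rw [Real.le_log_iff_exp_le (by linarith)]
    linarith [Real.exp_one_lt_d9]
  have hT' : (1 : ℝ) ≤ (T : ℝ) ^ 4 := one_le_pow₀ (by exact_mod_cast hT)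
  have hconst : 1 ≤ 2 * (T : ℝ) ^ 4 * 1 * (1 + θ) := by nlinarith
  have hmain : a ≤ 2 * (T : ℝ) ^ 4 * 1 * (1 + θ) * a * Real.log n ^ (3 / 2 : ℝ) :=
    calc a = 1 * a * 1 := by ring
      _ ≤ _ := by gcongr
  have hL' : (0 : ℝ) ≤ (L : ℝ) - 1 := by
    have : (1 : ℝ) ≤ L := by exact_mod_cast hL
    linarith
  have hpos : ENS ν (gaussianInit n N L) (staticClassifier 1 θ T sel) ≤ a ∧ (0 < (ν : ℝ) →
      4 * ENS ν (gaussianInit n N L) (staticClassifier 1 θ T sel) ≤ a) := by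
    have hENS : 0 ≤ ENS ν (gaussianInit n N L) (staticClassifier 1 θ T sel) := measureReal_nonneg
    have h4 : 0 < (ν : ℝ) → 4 * ENS ν (gaussianInit n N L) (staticClassifier 1 θ T sel) ≤ a :=
      fun hν0 => four_mul_ENS_staticClassifier_le (by omega) hθ T hN sel ν hν0
        (by rw [hN2]; push_cast; exact hsmall)
    refine ⟨?_, h4⟩
    -- Propagation needs a positive radius, so the rate `0` is treated separately.
    rcases ν.2.1.eq_or_lt with h0 | h0
    · obtain rfl : ν = 0 := Subtype.ext h0.symm
      rwa [ENS_zero]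
    · linarith [h4 h0]
  refine ⟨?_, fun hν0 => expectedSpectrumConcentrated_of_ENS_le sel ν hν0 hhalf
    ((hpos.2 hν0).trans hmain)⟩
  rw [add_assoc]
  exact (hpos.1.trans hmain).trans (le_add_of_nonneg_right (by positivity))
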